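/- All normed spaces are real. For $\varepsilon>0$, a linear map $f\colon X\to Y$ between normed spaces is called an $\varepsilon$-isometric embedding if $(1-\varepsilon)\|x\|\le\|f(x)\|\le(1+\varepsilon)\|x\|$ for all $x\in X$; isometric embeddings are linear by convention. The Gurarii space $\mathbb{G}$ is the unique, up to linear isometry, separable Banach space such that for every $\varepsilon>0$ and all finite-dimensional normed spaces $A\subseteq B$, every isometric embedding $A\to\mathbb{G}$ extends to an $\varepsilon$-isometric embedding $B\to\mathbb{G}$. Let $\mathcal F$ be a class of finite-dimensional normed spaces closed under linear isometries. It is called dominating if for every $E\in\mathcal F$, every isometric embedding $e\colon E\to X$ with $X$ a finite-dimensional normed space, and every $\varepsilon>0$, there are $F\in\mathcal F$ and an $\varepsilon$-isometric embedding $f\colon X\to F$ such that $f\circ e$ is an isometric embedding. In the game $\mathrm{BM}(\mathcal F)$ two players, Eve and Odd, alternately choose (Eve starting) members $E_0\subseteq E_1\subseteq E_2\subseteq\cdots$ of $\mathcal F$, where the norm of $E_{n+1}$ extends the norm of $E_n$; Eve chooses the spaces with even index, Odd those with odd index, and a strategy of Odd determines each of his moves from the finite chain played so far. Theorem 4.1.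 The Gurarii space $\mathbb{G}$ exists and is unique up to linear isometry, and if $\mathcal F$ is dominating, then Odd has a strategy in $\mathrm{BM}(\mathcal F)$ such that, for every play in which Odd uses it, the completion of the union $\bigcup_{n} E_n$ of the resulting chain is linearly isometric to $\mathbb{G}$. -/

import Mathlib

open Filter Topology

universe u

namespace BMGame

/-- A finite-dimensional real normed space. -/
structure FDSpace : Type (u + 1) where
  carrier : Type u
  [normedAddCommGroup : NormedAddCommGroup carrier]
  [normedSpace : NormedSpace ℝ carrier]
  [finiteDimensional : FiniteDimensional ℝ carrier]

instance : CoeSort FDSpace.{u} (Type u) := ⟨FDSpace.carrier⟩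

attribute [instance] FDSpace.normedAddCommGroup FDSpace.normedSpace FDSpace.finiteDimensional

/-- `f` is an `ε`-isometric embedding. -/
def IsEpsIsometric {X Y : Type u} [NormedAddCommGroup X] [NormedSpace ℝ X]
    [NormedAddCommGroup Y] [NormedSpace ℝ Y] (ε : ℝ) (f : X →ₗ[ℝ] Y) : Prop :=
  ∀ x : X, (1 - ε) * ‖x‖ ≤ ‖f x‖ ∧ ‖f x‖ ≤ (1 + ε) * ‖x‖

/-- `G` is a separable Banach space such that for all `ε > 0` and all finite-dimensional normed
spaces `A ⊆ B`, every isometric embedding of `A` into `G` extends to an `ε`-isometric embedding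
of `B` into `G`. -/
structure IsGurarii (G : Type u) [NormedAddCommGroup G] [NormedSpace ℝ G] : Prop where
  complete : CompleteSpace G
  separable : TopologicalSpace.SeparableSpace G
  extension : ∀ (ε : ℝ), 0 < ε → ∀ (B : FDSpace.{u}) (A : Submodule ℝ B) (e : A →ₗᵢ[ℝ] G),
    ∃ f : B →ₗ[ℝ] G, (∀ a : A, f a = e a) ∧ IsEpsIsometric ε f

/-- The class `𝓕` is closed under linear isometries. -/
def ClosedUnderIsometries (𝓕 : Set FDSpace.{u}) : Prop :=
  ∀ E E' : FDSpace.{u}, E ∈ 𝓕 → Nonempty (E ≃ₗᵢ[ℝ] E') → E' ∈ 𝓕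

/-- The class `𝓕` is dominating in the class of all finite-dimensional normed spaces. -/
def Dominating (𝓕 : Set FDSpace.{u}) : Prop :=
  ∀ E ∈ 𝓕, ∀ (X : FDSpace.{u}) (e : E →ₗᵢ[ℝ] X) (ε : ℝ), 0 < ε →
    ∃ F ∈ 𝓕, ∃ f : X →ₗ[ℝ] F, IsEpsIsometric ε f ∧ ∀ x : E, ‖f (e x)‖ = ‖x‖

/-! ### The game

Inclusions `E ⊆ E'` of normed spaces are isometric embeddings `E →ₗᵢ[ℝ] E'`, so that a move
which enlarges `E` consists of a new space of the class and an isometric embedding of `E`. -/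

/-- A legal move after `E`: a space of the class `𝓕` containing `E` isometrically. -/
structure Move (𝓕 : Set FDSpace.{u}) (E : FDSpace.{u}) : Type (u + 1) where
  space : FDSpace.{u}
  mem : space ∈ 𝓕
  emb : E →ₗᵢ[ℝ] space

/-- `Position 𝓕 n E` is the type of finite sequences of legal moves `E₀ ⊆ E₁ ⊆ ⋯ ⊆ Eₙ` with
`Eₙ = E`. -/
inductive Position (𝓕 : Set FDSpace.{u}) : ℕ → FDSpace.{u} → Type (u + 1)
  | first (E : FDSpace.{u}) (hE : E ∈ 𝓕) : Position 𝓕 0 E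
  | extend {n : ℕ} {E : FDSpace.{u}} (p : Position 𝓕 n E) (m : Move 𝓕 E) :
      Position 𝓕 (n + 1) m.space

/-- A strategy of Odd. Eve plays the spaces with even index and Odd those with odd index, so Odd
has to move in the positions `E₀ ⊆ ⋯ ⊆ E₂ₖ`; the answer may depend on the whole position. -/
def OddStrategy (𝓕 : Set FDSpace.{u}) : Type (u + 1) :=
  ∀ (k : ℕ) (E : FDSpace.{u}), Position 𝓕 (2 * k) E → Move 𝓕 E

/-- A complete play: a chain `E₀ ⊆ E₁ ⊆ E₂ ⊆ ⋯` of members of `𝓕`. -/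
structure Chain (𝓕 : Set FDSpace.{u}) : Type (u + 1) where
  space : ℕ → FDSpace.{u}
  mem : ∀ n, space n ∈ 𝓕
  emb : ∀ n, space n →ₗᵢ[ℝ] space (n + 1)

namespace Chain

variable {𝓕 : Set FDSpace.{u}} (c : Chain 𝓕)

/-- The move played after `Eₙ`. -/
def move (n : ℕ) : Move 𝓕 (c.space n) where
  space := c.space (n + 1)
  mem := c.mem (n + 1)
  emb := c.emb n

/-- The position `E₀ ⊆ ⋯ ⊆ Eₙ` of the play. -/
def position : (n : ℕ) → Position 𝓕 n (c.space n)
  | 0 => .first (c.space 0) (c.mem 0)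
  | n + 1 => .extend (position n) (c.move n)

/-- Odd used the strategy `σ` in the play `c`. -/
def Follows (σ : OddStrategy 𝓕) : Prop :=
  ∀ k : ℕ, c.move (2 * k) = σ k (c.space (2 * k)) (c.position (2 * k))

/-! ### The union of a chain and its completion

An element of the union is represented by a sequence `xₙ ∈ Eₙ` such that `xₙ₊₁` is the image of
`xₙ` for all large `n`. Its norm is the eventual value of `‖xₙ‖`, and representatives at distance
zero are identified. -/

/-- The sequences `xₙ ∈ Eₙ` that are eventually constant along the chain. -/
def threads : Submodule ℝ (∀ n, c.space n) where
  carrier := {x | ∃ N, ∀ n ≥ N, x (n + 1) = c.emb n (x n)}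
  add_mem' := by
    rintro x y ⟨N, hN⟩ ⟨M, hM⟩
    refine ⟨max N M, fun n hn => ?_⟩
    simp [hN n (le_trans (le_max_left _ _) hn), hM n (le_trans (le_max_right _ _) hn)]
  zero_mem' := ⟨0, fun n _ => by simp⟩
  smul_mem' := by
    rintro r x ⟨N, hN⟩
    exact ⟨N, fun n hn => by simp [hN n hn]⟩

/-- The type of threads, without the topology of coordinatewise convergence. -/
def Thread : Type u := c.threads

instance : AddCommGroup c.Thread := inferInstanceAs (AddCommGroup c.threads)
instance : Module ℝ c.Thread := inferInstanceAs (Module ℝ c.threads)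

variable {c}

/-- The `n`-th member of a thread. -/
def Thread.term (x : c.Thread) (n : ℕ) : c.space n := x.1 n

theorem Thread.eventually_norm_eq (x : c.Thread) :
    ∃ a : ℝ, ∀ᶠ n in atTop, ‖x.term n‖ = a := by
  obtain ⟨N, hN⟩ := x.2
  refine ⟨‖x.term N‖, eventually_atTop.2 ⟨N, fun n hn => ?_⟩⟩
  induction n, hn using Nat.le_induction with
  | base => rfl
  | succ n hn ih =>
    rw [← ih]
    change ‖x.1 (n + 1)‖ = ‖x.1 n‖
    rw [hN n hn, LinearIsometry.norm_map]

noncomputable instance : Norm c.Thread := ⟨fun x => limUnder atTop fun n => ‖x.term n‖⟩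

theorem Thread.tendsto_norm (x : c.Thread) :
    Tendsto (fun n => ‖x.term n‖) atTop (𝓝 ‖x‖) := by
  obtain ⟨a, ha⟩ := x.eventually_norm_eq
  exact tendsto_nhds_limUnder ⟨a, tendsto_const_nhds.congr' (ha.mono fun _ h => h.symm)⟩

variable (c)

/-- The norm of threads as a seminorm of additive groups. -/
noncomputable def threadSeminorm : AddGroupSeminorm c.Thread where
  toFun x := ‖x‖
  map_zero' := tendsto_nhds_unique (Thread.tendsto_norm (0 : c.Thread)) <| by
    have h : (fun n => ‖Thread.term (0 : c.Thread) n‖) = fun _ => (0 : ℝ) :=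
      funext fun n => norm_zero
    rw [h]
    exact tendsto_const_nhds
  add_le' x y := le_of_tendsto_of_tendsto' (x + y).tendsto_norm
    (x.tendsto_norm.add y.tendsto_norm) fun n => norm_add_le (x.term n) (y.term n)
  neg' x := tendsto_nhds_unique (-x).tendsto_norm <| by
    have h : (fun n => ‖(-x).term n‖) = fun n => ‖x.term n‖ :=
      funext fun n => norm_neg (x.term n)
    rw [h]
    exact x.tendsto_norm

noncomputable instance : SeminormedAddCommGroup c.Thread :=
  c.threadSeminorm.toSeminormedAddCommGroup

noncomputable instance : NormedSpace ℝ c.Thread where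
  norm_smul_le r x := le_of_eq <| tendsto_nhds_unique (r • x).tendsto_norm <| by
    have h : (fun n => ‖(r • x).term n‖) = fun n => ‖r‖ * ‖x.term n‖ :=
      funext fun n => norm_smul r (x.term n)
    rw [h]
    exact x.tendsto_norm.const_mul ‖r‖

/-- The normed space `⋃ₙ Eₙ`. -/
abbrev Union : Type u := SeparationQuotient c.Thread

/-- The completion of `⋃ₙ Eₙ`, a Banach space. -/
abbrev Completion : Type u := UniformSpace.Completion c.Union

end Chain

end BMGame

/-! An extension problem in `E` is a linear map `T : ℝᵏ → E` that distorts a seminorm `size` by at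
most a seminorm `error`; to solve it is to replace `T`, at a cost of about `error`, by an almost
isometric map. Every problem is solved exactly in an amalgam of `ℝᵏ` and `E` in which `w` and `T w`
are at distance at most `error w` (`exists_amalgam`). Uniqueness: a Gurarii space absorbs amalgams,
so it solves all its problems (`IsGurarii.solvable`), and two separable Banach spaces with this
property are isometric by an approximate back-and-forth (`AlmostIsometric.extend`). Strategy: a
finite-dimensional space has a countable dense family of problems (`exists_dense`), and domination
sends an amalgam into a member of the class without distorting `E` (`Dominating.exists_move`). Odd
can thus solve one problem per move and, by bookkeeping, all of them. A completion in which the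
dense problems are solved is Gurarii by perturbation (`SolvesDense.isGurarii`). Existence is the
case of the class of all finite-dimensional spaces. -/

namespace BMGame

/-! ### Extension problems and amalgams -/

/-- The problem of extending a linear map `T` into `E` to an almost isometric copy of a seminorm. -/
structure ExtensionProblem (k : ℕ) (E : Type u) [NormedAddCommGroup E] [NormedSpace ℝ E] where
  /-- the seminorm to be copied -/
  size : Seminorm ℝ (Fin k → ℝ)
  /-- the allowed error -/
  error : Seminorm ℝ (Fin k → ℝ)
  /-- the map to be approximated -/
  map : (Fin k → ℝ) →ₗ[ℝ] E
  compat : ∀ w, |size w - ‖map w‖| ≤ error w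

namespace ExtensionProblem

section

variable {k : ℕ} {E F : Type u} [NormedAddCommGroup E] [NormedSpace ℝ E]
  [NormedAddCommGroup F] [NormedSpace ℝ F]

/-- `Q` has a solution with tolerance `ε`. -/
def Solvable (Q : ExtensionProblem k E) (ε : ℝ) : Prop :=
  ∃ f : (Fin k → ℝ) →ₗ[ℝ] E, ∀ w,
    (1 - ε) * Q.size w ≤ ‖f w‖ ∧ ‖f w‖ ≤ (1 + ε) * Q.size w ∧
      ‖f w - Q.map w‖ ≤ (1 + ε) * Q.error w

/-- The image of a problem under an isometric embedding. -/
def push (Q : ExtensionProblem k E) (e : E →ₗᵢ[ℝ] F) : ExtensionProblem k F where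
  size := Q.size
  error := Q.error
  map := e.toLinearMap ∘ₗ Q.map
  compat w := by simpa using Q.compat w

theorem Solvable.push {Q : ExtensionProblem k E} {ε : ℝ} (h : Q.Solvable ε) (e : E →ₗᵢ[ℝ] F) :
    (Q.push e).Solvable ε := by
  obtain ⟨f, hf⟩ := h
  refine ⟨e.toLinearMap ∘ₗ f, fun w => ?_⟩
  have h3 : ‖e (f w) - e (Q.map w)‖ = ‖f w - Q.map w‖ := by rw [← map_sub, e.norm_map]
  obtain ⟨h0, h1, h2⟩ := hf w
  refine ⟨?_, ?_, ?_⟩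
  · simpa [ExtensionProblem.push] using h0
  · simpa [ExtensionProblem.push] using h1
  · simpa [ExtensionProblem.push, h3] using h2

/-- The vector space underlying the amalgam of the seminorm and the target of the map. -/
def Amalgam (_ : ExtensionProblem k E) : Type u := (Fin k → ℝ) × E

variable (Q : ExtensionProblem k E)

instance : AddCommGroup Q.Amalgam := inferInstanceAs (AddCommGroup ((Fin k → ℝ) × E))
instance : Module ℝ Q.Amalgam := inferInstanceAs (Module ℝ ((Fin k → ℝ) × E))

/-- The cost of the splitting of `z` given by `w`. -/
def cost (z : (Fin k → ℝ) × E) (w : Fin k → ℝ) : ℝ :=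
  -- The three terms price the pieces of `z = (z.1 - w, 0) + (0, z.2 + T w) + (w, -T w)`, where `T`
  -- is `Q.map`.
  Q.size (z.1 - w) + ‖z.2 + Q.map w‖ + Q.error w

theorem cost_nonneg (z : (Fin k → ℝ) × E) (w : Fin k → ℝ) : 0 ≤ Q.cost z w :=
  add_nonneg (add_nonneg (apply_nonneg _ _) (norm_nonneg _)) (apply_nonneg _ _)

theorem iInf_cost_le (z : (Fin k → ℝ) × E) (w : Fin k → ℝ) : ⨅ v, Q.cost z v ≤ Q.cost z w :=
  ciInf_le ⟨0, by rintro _ ⟨v, rfl⟩; exact Q.cost_nonneg z v⟩ w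

/-- The seminorm of the amalgam. -/
noncomputable def amalgamSeminorm : Seminorm ℝ Q.Amalgam :=
  Seminorm.ofSMulLE (fun z => ⨅ w, Q.cost z w)
    (le_antisymm ((Q.iInf_cost_le 0 0).trans (by simp [cost]))
      (le_ciInf fun w => Q.cost_nonneg _ w))
    (fun x y => by
      refine le_of_forall_pos_le_add fun ε hε => ?_
      obtain ⟨v, hv⟩ := exists_lt_of_ciInf_lt (lt_add_of_pos_right (⨅ w, Q.cost x w) (half_pos hε))
      obtain ⟨w, hw⟩ := exists_lt_of_ciInf_lt (lt_add_of_pos_right (⨅ w, Q.cost y w) (half_pos hε))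
      have h := Q.iInf_cost_le (x + y) (v + w)
      have h1 := map_add_le_add Q.size (x.1 - v) (y.1 - w)
      have h2 := norm_add_le (x.2 + Q.map v) (y.2 + Q.map w)
      have h3 := map_add_le_add Q.error v w
      have e1 : x.1 - v + (y.1 - w) = (x.1 + y.1) - (v + w) := by abel
      have e2 : x.2 + Q.map v + (y.2 + Q.map w) = x.2 + y.2 + Q.map (v + w) := by
        rw [map_add]; abel
      rw [e1] at h1
      rw [e2] at h2
      have h4 : Q.cost (x + y) (v + w) ≤ Q.cost x v + Q.cost y w := by
        change Q.size ((x.1 + y.1) - (v + w)) + ‖x.2 + y.2 + Q.map (v + w)‖ + Q.error (v + w) ≤ _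
        unfold cost
        linarith
      change (⨅ u, Q.cost (x + y) u) ≤ _
      linarith)
    (fun r x => by
      rw [Real.mul_iInf_of_nonneg (norm_nonneg r)]
      refine le_ciInf fun w => (Q.iInf_cost_le (r • x) (r • w)).trans (le_of_eq ?_)
      change Q.size (r • x.1 - r • w) + ‖r • x.2 + Q.map (r • w)‖ + Q.error (r • w) = _
      rw [map_smul, ← smul_sub, ← smul_add, map_smul_eq_mul, map_smul_eq_mul, norm_smul]
      unfold cost
      ring)

noncomputable instance : SeminormedAddCommGroup Q.Amalgam :=
  Q.amalgamSeminorm.toAddGroupSeminorm.toSeminormedAddCommGroup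

noncomputable instance : NormedSpace ℝ Q.Amalgam where
  norm_smul_le r x := (map_smul_eq_mul Q.amalgamSeminorm r x).le

/-- The embedding of the seminormed space into the amalgam. -/
def Amalgam.inl : (Fin k → ℝ) →ₗ[ℝ] Q.Amalgam := LinearMap.inl ℝ (Fin k → ℝ) E

/-- The embedding of the target of the map into the amalgam. -/
def Amalgam.inr : E →ₗ[ℝ] Q.Amalgam := LinearMap.inr ℝ (Fin k → ℝ) E

/-- No splitting is cheaper than `w = 0`, because `size w ≤ ‖T w‖ + error w`. The other half of
`compat` plays the same role in `norm_inr`. -/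
theorem Amalgam.norm_inl (x : Fin k → ℝ) : ‖Amalgam.inl Q x‖ = Q.size x := by
  change ⨅ w, Q.cost (x, 0) w = _
  refine le_antisymm (by simpa [cost] using Q.iInf_cost_le (x, 0) 0) (le_ciInf fun w => ?_)
  have h1 := map_add_le_add Q.size (x - w) w
  have h2 := (abs_le.1 (Q.compat w)).2
  rw [sub_add_cancel] at h1
  simp only [cost, zero_add]
  linarith

theorem Amalgam.norm_inr (y : E) : ‖Amalgam.inr Q y‖ = ‖y‖ := by
  change ⨅ w, Q.cost (0, y) w = _
  refine le_antisymm (by simpa [cost] using Q.iInf_cost_le (0, y) 0) (le_ciInf fun w => ?_)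
  have h1 := norm_sub_le (y + Q.map w) (Q.map w)
  have h2 := (abs_le.1 (Q.compat w)).1
  rw [add_sub_cancel_right] at h1
  simp only [cost, zero_sub, map_neg_eq_map]
  linarith

theorem Amalgam.norm_inl_sub_inr_le (w : Fin k → ℝ) :
    ‖Amalgam.inl Q w - Amalgam.inr Q (Q.map w)‖ ≤ Q.error w := by
  have h : Amalgam.inl Q w - Amalgam.inr Q (Q.map w) = ((w, -Q.map w) : (Fin k → ℝ) × E) :=
    Prod.ext (sub_zero w) (zero_sub (Q.map w))
  rw [h]
  exact (Q.iInf_cost_le (w, -Q.map w) w).trans (by simp [cost])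

end

/-- The amalgam as a finite-dimensional normed space. -/
noncomputable def amalgamSpace {k : ℕ} {E : FDSpace.{u}} (Q : ExtensionProblem k E) :
    FDSpace.{u} :=
  letI : Module.Finite ℝ Q.Amalgam := inferInstanceAs (Module.Finite ℝ ((Fin k → ℝ) × E))
  -- `size` and `error` may degenerate, so the null vectors are divided out.
  { carrier := SeparationQuotient Q.Amalgam
    finiteDimensional := Module.Finite.of_surjective
      (SeparationQuotient.mkCLM ℝ Q.Amalgam).toLinearMap SeparationQuotient.surjective_mk }

theorem exists_amalgam {k : ℕ} {E : FDSpace.{u}} (Q : ExtensionProblem k E) :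
    ∃ (Z : FDSpace.{u}) (J : E →ₗᵢ[ℝ] Z) (I : (Fin k → ℝ) →ₗ[ℝ] Z),
      (∀ w, ‖I w‖ = Q.size w) ∧ ∀ w, ‖I w - J (Q.map w)‖ ≤ Q.error w := by
  let q : Q.Amalgam →ₗ[ℝ] SeparationQuotient Q.Amalgam :=
    (SeparationQuotient.mkCLM ℝ Q.Amalgam).toLinearMap
  have hq : ∀ z, ‖q z‖ = ‖z‖ := fun z => SeparationQuotient.norm_mk z
  refine ⟨Q.amalgamSpace,
    ⟨q ∘ₗ Amalgam.inr Q, fun y => (hq _).trans (Amalgam.norm_inr (Q := Q) y)⟩,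
    q ∘ₗ Amalgam.inl Q, fun w => (hq _).trans (Amalgam.norm_inl (Q := Q) w), fun w => ?_⟩
  change ‖q (Amalgam.inl Q w) - q (Amalgam.inr Q (Q.map w))‖ ≤ _
  rw [← map_sub, hq]
  exact Amalgam.norm_inl_sub_inr_le (Q := Q) w

end ExtensionProblem

/-- The problem lives in the finite-dimensional range of its map. The inclusion of that range
extends to the amalgam, and applying the extension to `I w - J (T w)` gives the bound `(1 + ε) *
error w`. -/
theorem IsGurarii.solvable {H : Type u} [NormedAddCommGroup H] [NormedSpace ℝ H]
    (hH : IsGurarii H) {k : ℕ} (Q : ExtensionProblem k H) {ε : ℝ} (hε : 0 < ε) :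
    Q.Solvable ε := by
  let E : FDSpace.{u} := { carrier := LinearMap.range Q.map }
  let R : ExtensionProblem k E :=
    { size := Q.size, error := Q.error, map := Q.map.rangeRestrict, compat := Q.compat }
  obtain ⟨Z, J, I, hI, hIJ⟩ := R.exists_amalgam
  let A : Submodule ℝ Z := LinearMap.range J.toLinearMap
  let φ : E ≃ₗᵢ[ℝ] A := J.equivRange
  let e : A →ₗᵢ[ℝ] H := (LinearMap.range Q.map).subtypeₗᵢ.comp φ.symm.toLinearIsometry
  obtain ⟨f, hf, hfe⟩ := hH.extension ε hε Z A e
  have hJ : ∀ y : E, f (J y) = (y : LinearMap.range Q.map).1 := fun y => by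
    have h := hf (φ y)
    have h2 : e (φ y) = (y : LinearMap.range Q.map).1 := by
      change ((φ.symm (φ y) : LinearMap.range Q.map) : H) = _
      rw [φ.symm_apply_apply]
    rw [← h2, ← h]
    rfl
  refine ⟨f ∘ₗ I, fun w => ⟨?_, ?_, ?_⟩⟩
  · have := (hfe (I w)).1
    rwa [hI w] at this
  · have := (hfe (I w)).2
    rwa [hI w] at this
  · have h := hJ (R.map w)
    have h2 := (hfe (I w - J (R.map w))).2
    rw [map_sub, h] at h2
    exact h2.trans (mul_le_mul_of_nonneg_left (hIJ w) (by linarith))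

/-! ### Uniqueness by approximate back-and-forth -/

/-- All extension problems in `H` can be solved with arbitrarily small positive tolerance. -/
def SolvesAll (H : Type u) [NormedAddCommGroup H] [NormedSpace ℝ H] : Prop :=
  ∀ (k : ℕ) (Q : ExtensionProblem k H) (ε : ℝ), 0 < ε → Q.Solvable ε

theorem exists_tendsto_of_geometric {G : Type*} [NormedAddCommGroup G] [CompleteSpace G]
    {u : ℕ → G} {m : ℕ}
    (h : ∀ j ≥ m, ‖u (j + 1) - u j‖ ≤ 2 * (1 / 2) ^ j) :
    ∃ l, Tendsto u atTop (𝓝 l) ∧ ‖u m - l‖ ≤ 4 * (1 / 2) ^ m := by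
  have h1 : ∀ j, dist (u (j + m)) (u (j + 1 + m)) ≤ 2 * (1 / 2) ^ m * (1 / 2) ^ j := fun j => by
    have := h (j + m) (by omega)
    rw [dist_comm, dist_eq_norm, add_right_comm]
    refine this.trans (le_of_eq ?_)
    rw [pow_add]
    ring
  obtain ⟨l, hl⟩ := cauchySeq_tendsto_of_complete
    (cauchySeq_of_le_geometric (1 / 2 : ℝ) _ (by norm_num) h1)
  refine ⟨l, (tendsto_add_atTop_iff_nat m).1 hl, ?_⟩
  have h2 := dist_le_of_le_geometric_of_tendsto₀ (1 / 2 : ℝ) _ (by norm_num) h1 hl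
  rw [dist_eq_norm, zero_add] at h2
  refine h2.trans (le_of_eq ?_)
  ring

section

variable {G H : Type u} [NormedAddCommGroup G] [NormedSpace ℝ G]
  [NormedAddCommGroup H] [NormedSpace ℝ H]

/-- The first `n` terms of `x` and `y` are almost isometric. -/
def AlmostIsometric (n : ℕ) (ε : ℝ) (x : ℕ → G) (y : ℕ → H) : Prop :=
  ∀ a : ℕ → ℝ, |‖∑ i ∈ Finset.range n, a i • x i‖ - ‖∑ i ∈ Finset.range n, a i • y i‖| ≤
    ε * ∑ i ∈ Finset.range n, |a i|

theorem AlmostIsometric.symm {n : ℕ} {ε : ℝ} {x : ℕ → G} {y : ℕ → H}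
    (h : AlmostIsometric n ε x y) : AlmostIsometric n ε y x := fun a => by
  rw [abs_sub_comm]
  exact h a

theorem AlmostIsometric.congr {n : ℕ} {ε : ℝ} {x x' : ℕ → G} {y : ℕ → H}
    (h : AlmostIsometric n ε x y) (hx : ∀ i < n, x' i = x i) : AlmostIsometric n ε x' y :=
  fun a => by
    rw [Finset.sum_congr rfl fun i hi => by rw [hx i (Finset.mem_range.1 hi)]]
    exact h a

/-- A weighted `ℓ¹` seminorm. -/
noncomputable def weightedSeminorm {k : ℕ} (c : Fin k → ℝ) (hc : ∀ i, 0 ≤ c i) :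
    Seminorm ℝ (Fin k → ℝ) :=
  Seminorm.of (fun a => ∑ i, c i * |a i|)
    (fun a b => by
      rw [← Finset.sum_add_distrib]
      refine Finset.sum_le_sum fun i _ => ?_
      rw [← mul_add]
      exact mul_le_mul_of_nonneg_left (abs_add_le _ _) (hc i))
    (fun r a => by
      rw [Finset.mul_sum]
      refine Finset.sum_congr rfl fun i _ => ?_
      simp only [Pi.smul_apply, smul_eq_mul, abs_mul, Real.norm_eq_abs]
      ring)

theorem weightedSeminorm_apply {k : ℕ} (c : Fin k → ℝ) (hc : ∀ i, 0 ≤ c i) (a : Fin k → ℝ) :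
    weightedSeminorm c hc a = ∑ i, c i * |a i| := rfl

/-- One vector is added and the tolerance drops from `ε` to an arbitrary `δ`, while the old vectors
move only by a multiple of `ε`; this makes the iteration converge. -/
theorem AlmostIsometric.extend (hH : SolvesAll H) {n : ℕ} {ε δ : ℝ} (hε : 0 < ε) (hδ : 0 < δ)
    {x : ℕ → G} {y : ℕ → H} (h : AlmostIsometric n ε x y) :
    ∃ y' : ℕ → H, (∀ i < n, ‖y' i - y i‖ ≤ 2 * ε) ∧ AlmostIsometric (n + 1) δ x y' := by
  let S : (Fin (n + 1) → ℝ) →ₗ[ℝ] G := Fintype.linearCombination ℝ fun i => x i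
  let T : (Fin (n + 1) → ℝ) →ₗ[ℝ] H := Fintype.linearCombination ℝ fun i => y i
  have hS : ∀ a : ℕ → ℝ, S (fun i => a i) = ∑ i ∈ Finset.range (n + 1), a i • x i := fun a => by
    rw [Finset.sum_range]
    exact Fintype.linearCombination_apply ..
  have hT : ∀ a : ℕ → ℝ, T (fun i => a i) = ∑ i ∈ Finset.range (n + 1), a i • y i := fun a => by
    rw [Finset.sum_range]
    exact Fintype.linearCombination_apply ..
  -- The last weight pays for the whole contribution of `x n` and `y n`, so nothing needs to be
  -- known about `y n`.
  let c : ℕ → ℝ := fun i => if i < n then ε else ‖x n‖ + ‖y n‖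
  have hc : ∀ i, 0 ≤ c i := fun i => by
    unfold c
    split_ifs <;> positivity
  have hext : ∀ w : Fin (n + 1) → ℝ, ∃ a : ℕ → ℝ, w = fun i : Fin (n + 1) => a i := fun w =>
    ⟨fun i => if h : i < n + 1 then w ⟨i, h⟩ else 0,
      funext fun i => by simp only [i.2, dif_pos]⟩
  let Q : ExtensionProblem (n + 1) H :=
    -- Only a seminorm: the `x i` may be linearly dependent.
    { size := (normSeminorm ℝ G).comp S
      error := weightedSeminorm (fun i => c i) fun i => hc i
      map := T
      compat := fun w => by
        obtain ⟨a, rfl⟩ := hext w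
        change |‖S _‖ - ‖T _‖| ≤ _
        rw [hS, hT, weightedSeminorm_apply, ← Finset.sum_range fun i => c i * |a i|,
          Finset.sum_range_succ, Finset.sum_range_succ, Finset.sum_range_succ]
        have h1 := h a
        have h2 := norm_add_le (∑ i ∈ Finset.range n, a i • x i) (a n • x n)
        have h3 := norm_add_le (∑ i ∈ Finset.range n, a i • y i) (a n • y n)
        have h4 := norm_sub_le_norm_add (∑ i ∈ Finset.range n, a i • x i) (a n • x n)
        have h5 := norm_sub_le_norm_add (∑ i ∈ Finset.range n, a i • y i) (a n • y n)
        have h6 : ∑ i ∈ Finset.range n, c i * |a i| = ε * ∑ i ∈ Finset.range n, |a i| := by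
          rw [Finset.mul_sum]
          refine Finset.sum_congr rfl fun i hi => ?_
          simp [c, Finset.mem_range.1 hi]
        have h7 : c n * |a n| = ‖a n • x n‖ + ‖a n • y n‖ := by
          simp [c, norm_smul]
          ring
        rw [h6, h7]
        rw [abs_le] at h1 ⊢
        constructor <;> linarith }
  set M : ℝ := ∑ i ∈ Finset.range (n + 1), ‖x i‖ with hM
  have hM0 : 0 ≤ M := Finset.sum_nonneg fun i _ => norm_nonneg _
  -- `η ≤ 1` gives `(1 + η) * ε ≤ 2 * ε`; the other bound turns the relative error `η` into `δ * ∑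
  -- |a i|`.
  set η : ℝ := min 1 (δ / (M + 1)) with hη
  have hη0 : 0 < η := by positivity
  obtain ⟨f, hf⟩ := hH _ Q η hη0
  let y' : ℕ → H := fun i => if h : i < n + 1 then f (Pi.single ⟨i, h⟩ 1) else 0
  have hfa : ∀ a : ℕ → ℝ, f (fun i => a i) = ∑ i ∈ Finset.range (n + 1), a i • y' i := fun a => by
    rw [LinearMap.pi_apply_eq_sum_univ f, Finset.sum_range]
    refine Finset.sum_congr rfl fun i _ => ?_
    simp only [y', i.2, dif_pos]
    congr 2
    ext j
    simp [Pi.single_apply, eq_comm]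
  refine ⟨y', fun i hi => ?_, fun a => ?_⟩
  · have hi' : i < n + 1 := by omega
    have h1 := (hf (Pi.single ⟨i, hi'⟩ 1)).2.2
    have h2 : Q.map (Pi.single ⟨i, hi'⟩ 1) = y i := by
      change T _ = _
      simp [T, Fintype.linearCombination_apply_single]
    have h3 : Q.error (Pi.single ⟨i, hi'⟩ 1) = ε := by
      change ∑ j : Fin (n + 1), c j * |(Pi.single (⟨i, hi'⟩ : Fin (n + 1)) (1 : ℝ) :
        Fin (n + 1) → ℝ) j| = ε
      rw [Finset.sum_eq_single ⟨i, hi'⟩]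
      · simp [c, hi]
      · intro j _ hj
        simp [hj]
      · simp
    rw [h2, h3] at h1
    have h4 : y' i = f (Pi.single ⟨i, hi'⟩ 1) := dif_pos hi'
    rw [h4]
    refine h1.trans (mul_le_mul_of_nonneg_right ?_ hε.le)
    have := min_le_left 1 (δ / (M + 1))
    linarith
  · obtain ⟨h1, h2, -⟩ := hf fun i => a i
    rw [hfa] at h1 h2
    have h3 : Q.size (fun i => a i) = ‖∑ i ∈ Finset.range (n + 1), a i • x i‖ :=
      congrArg norm (hS a)
    rw [h3] at h1 h2
    set A := ∑ i ∈ Finset.range (n + 1), |a i| with hA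
    have hA0 : 0 ≤ A := Finset.sum_nonneg fun i _ => abs_nonneg _
    have h4 : ‖∑ i ∈ Finset.range (n + 1), a i • x i‖ ≤ M * A := by
      refine (norm_sum_le _ _).trans ?_
      rw [hA, Finset.mul_sum]
      refine Finset.sum_le_sum fun i hi => ?_
      rw [norm_smul, mul_comm]
      exact mul_le_mul_of_nonneg_right
        (Finset.single_le_sum (f := fun i => ‖x i‖) (fun j _ => norm_nonneg _) hi) (abs_nonneg _)
    have h5 : η * ‖∑ i ∈ Finset.range (n + 1), a i • x i‖ ≤ δ * A := by
      calc _ ≤ (δ / (M + 1)) * (M * A) :=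
            mul_le_mul (min_le_right _ _) h4 (norm_nonneg _) (by positivity)
        _ = δ * A * (M / (M + 1)) := by ring
        _ ≤ δ * A * 1 := by
            refine mul_le_mul_of_nonneg_left ?_ (by positivity)
            rw [div_le_one (by positivity)]
            linarith
        _ = δ * A := mul_one _
    rw [abs_le]
    constructor <;> linarith

/-- Stage `j` inserts `z j` on the left at index `2 * j` and `z' j` on the right at `2 * j + 1`,
each time finding a partner on the other side. The second half-step still moves the left vectors, so
`z j` is matched only approximately. -/
theorem exists_backAndForth (hG : SolvesAll G) (hH : SolvesAll H) (z : ℕ → G) (z' : ℕ → H) :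
    ∃ (x : ℕ → ℕ → G) (y : ℕ → ℕ → H), ∀ j,
      AlmostIsometric (2 * j) ((1 / 2) ^ j) (x j) (y j) ∧
      (∀ i < 2 * j, ‖x (j + 1) i - x j i‖ ≤ 2 * (1 / 2) ^ j) ∧
      (∀ i < 2 * j, ‖y (j + 1) i - y j i‖ ≤ 2 * (1 / 2) ^ j) ∧
      ‖x (j + 1) (2 * j) - z j‖ ≤ 2 * (1 / 2) ^ j ∧ y (j + 1) (2 * j + 1) = z' j := by
  have step : ∀ (j : ℕ) (s : {s : (ℕ → G) × (ℕ → H) //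
      AlmostIsometric (2 * j) ((1 / 2) ^ j) s.1 s.2}),
      ∃ t : {s : (ℕ → G) × (ℕ → H) //
        AlmostIsometric (2 * (j + 1)) ((1 / 2) ^ (j + 1)) s.1 s.2},
      (∀ i < 2 * j, ‖t.1.1 i - s.1.1 i‖ ≤ 2 * (1 / 2) ^ j) ∧
      (∀ i < 2 * j, ‖t.1.2 i - s.1.2 i‖ ≤ 2 * (1 / 2) ^ j) ∧
      ‖t.1.1 (2 * j) - z j‖ ≤ 2 * (1 / 2) ^ j ∧ t.1.2 (2 * j + 1) = z' j := by
    rintro j ⟨⟨x, y⟩, h⟩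
    have hp : (0 : ℝ) < (1 / 2) ^ j := by positivity
    have h1 := h.congr (x' := Function.update x (2 * j) (z j)) fun i hi =>
      Function.update_of_ne hi.ne _ _
    obtain ⟨y', hy', h2⟩ := h1.extend hH hp hp
    have h3 := h2.symm.congr (x' := Function.update y' (2 * j + 1) (z' j)) fun i hi =>
      Function.update_of_ne hi.ne _ _
    obtain ⟨x', hx', h4⟩ := h3.extend hG hp (δ := (1 / 2) ^ (j + 1)) (by positivity)
    refine ⟨⟨(x', Function.update y' (2 * j + 1) (z' j)), h4.symm⟩, fun i hi => ?_,
      fun i hi => ?_, ?_, ?_⟩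
    · have := hx' i (by omega)
      rwa [Function.update_of_ne hi.ne] at this
    · have := hy' i hi
      change ‖Function.update y' (2 * j + 1) (z' j) i - y i‖ ≤ _
      rwa [Function.update_of_ne (by omega)]
    · have := hx' (2 * j) (by omega)
      rwa [Function.update_self] at this
    · simp
  choose F hF using step
  let s : ∀ j, {s : (ℕ → G) × (ℕ → H) // AlmostIsometric (2 * j) ((1 / 2) ^ j) s.1 s.2} :=
    fun j => Nat.rec ⟨(0, 0), fun a => by simp⟩ F j
  exact ⟨fun j => (s j).1.1, fun j => (s j).1.2, fun j => ⟨(s j).2, hF j (s j)⟩⟩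

/-- Each `d k` is treated at all stages `Nat.pair k m`, hence with arbitrarily small error. -/
theorem denseRange_linearCombination {x : ℕ → G} {d : ℕ → G} (hd : DenseRange d)
    (h : ∀ j, ∃ i, ‖x i - d (Nat.unpair j).1‖ ≤ 8 * (1 / 2) ^ j) :
    DenseRange (Finsupp.linearCombination ℝ x) := by
  have hx : DenseRange x := by
    refine Metric.denseRange_iff.2 fun g η hη => ?_
    obtain ⟨k, hk⟩ := Metric.denseRange_iff.1 hd g (η / 2) (by positivity)
    obtain ⟨m, hm⟩ := exists_pow_lt_of_lt_one (show 0 < η / 16 by positivity)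
      (show (1 / 2 : ℝ) < 1 by norm_num)
    obtain ⟨i, hi⟩ := h (Nat.pair k m)
    rw [Nat.unpair_pair] at hi
    refine ⟨i, ?_⟩
    have h1 : (1 / 2 : ℝ) ^ Nat.pair k m ≤ (1 / 2) ^ m :=
      pow_le_pow_of_le_one (by norm_num) (by norm_num) (Nat.right_le_pair k m)
    have h2 := dist_triangle g (d k) (x i)
    rw [dist_comm (d k), dist_eq_norm (x i)] at h2
    dsimp only at hi
    linarith
  refine hx.mono ?_
  rintro _ ⟨i, rfl⟩
  exact ⟨Finsupp.single i 1, by simp⟩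

theorem tendsto_linearCombination {x : ℕ → ℕ → G} {l : ℕ → G}
    (h : ∀ i, Tendsto (fun j => x j i) atTop (𝓝 (l i))) (a : ℕ →₀ ℝ) :
    Tendsto (fun j => Finsupp.linearCombination ℝ (x j) a) atTop
      (𝓝 (Finsupp.linearCombination ℝ l a)) := by
  simp only [Finsupp.linearCombination_apply, Finsupp.sum]
  exact tendsto_finsetSum _ fun i _ => (h i).const_smul _

theorem SolvesAll.nonempty_linearIsometryEquiv [CompleteSpace G] [CompleteSpace H]
    [TopologicalSpace.SeparableSpace G] [TopologicalSpace.SeparableSpace H]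
    (hG : SolvesAll G) (hH : SolvesAll H) : Nonempty (G ≃ₗᵢ[ℝ] H) := by
  obtain ⟨x, y, h⟩ := exists_backAndForth hG hH
    (fun j => TopologicalSpace.denseSeq G (Nat.unpair j).1)
    (fun j => TopologicalSpace.denseSeq H (Nat.unpair j).1)
  -- Index `i` is controlled from stage `i / 2 + 1` on, the first `j` with `i < 2 * j`.
  have hx : ∀ i, ∃ l, Tendsto (fun j => x j i) atTop (𝓝 l) ∧
      ‖x (i / 2 + 1) i - l‖ ≤ 4 * (1 / 2) ^ (i / 2 + 1) := fun i =>
    exists_tendsto_of_geometric fun j hj => (h j).2.1 i (by omega)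
  have hy : ∀ i, ∃ l, Tendsto (fun j => y j i) atTop (𝓝 l) ∧
      ‖y (i / 2 + 1) i - l‖ ≤ 4 * (1 / 2) ^ (i / 2 + 1) := fun i =>
    exists_tendsto_of_geometric fun j hj => (h j).2.2.1 i (by omega)
  choose lx hlx hlx' using hx
  choose ly hly hly' using hy
  have hdx : DenseRange (Finsupp.linearCombination ℝ lx) := by
    refine denseRange_linearCombination (TopologicalSpace.denseRange_denseSeq G)
      fun j => ⟨2 * j, ?_⟩
    have h1 := hlx' (2 * j)
    rw [show 2 * j / 2 + 1 = j + 1 by omega, norm_sub_rev] at h1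
    have h2 := (h j).2.2.2.1
    have h3 := norm_sub_le_norm_sub_add_norm_sub (lx (2 * j)) (x (j + 1) (2 * j))
      (TopologicalSpace.denseSeq G (Nat.unpair j).1)
    have h4 : (0 : ℝ) < (1 / 2) ^ j := by positivity
    rw [pow_succ] at h1
    linarith
  have hdy : DenseRange (Finsupp.linearCombination ℝ ly) := by
    refine denseRange_linearCombination (TopologicalSpace.denseRange_denseSeq H)
      fun j => ⟨2 * j + 1, ?_⟩
    have h1 := hly' (2 * j + 1)
    rw [show (2 * j + 1) / 2 + 1 = j + 1 by omega, norm_sub_rev, (h j).2.2.2.2] at h1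
    have h4 : (0 : ℝ) < (1 / 2) ^ j := by positivity
    rw [pow_succ] at h1
    linarith
  -- Equal norms of corresponding combinations suffice, even if the limit vectors are dependent.
  refine ⟨LinearEquiv.extendOfIsometry (LinearEquiv.refl ℝ (ℕ →₀ ℝ)) _ _ hdx hdy fun a => ?_⟩
  have h1 := ((tendsto_linearCombination hlx a).norm.sub (tendsto_linearCombination hly a).norm)
  have h2 : Tendsto (fun j : ℕ => (1 / 2 : ℝ) ^ j * ∑ i ∈ a.support, |a i|) atTop (𝓝 0) := by
    simpa using (tendsto_pow_atTop_nhds_zero_of_lt_one (r := (1 / 2 : ℝ)) (by norm_num)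
      (by norm_num)).mul_const (∑ i ∈ a.support, |a i|)
  have h3 : ∀ᶠ j in atTop, ‖‖Finsupp.linearCombination ℝ (x j) a‖ -
      ‖Finsupp.linearCombination ℝ (y j) a‖‖ ≤ (1 / 2 : ℝ) ^ j * ∑ i ∈ a.support, |a i| := by
    obtain ⟨n, hn⟩ := a.support.exists_nat_subset_range
    filter_upwards [eventually_ge_atTop n] with j hj
    have hsub : a.support ⊆ Finset.range (2 * j) :=
      hn.trans (Finset.range_subset_range.2 (by omega))
    have h4 := (h j).1 a
    rw [Finsupp.linearCombination_apply, Finsupp.linearCombination_apply,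
      Finsupp.sum_of_support_subset a hsub _ (by simp),
      Finsupp.sum_of_support_subset a hsub _ (by simp), Finset.sum_subset hsub (by simp_all)]
    exact h4
  have h5 := tendsto_nhds_unique h1 (squeeze_zero_norm' h3 h2)
  exact (sub_eq_zero.1 h5).symm

end

/-! ### The union of a chain and its completion -/

namespace Chain

variable {𝓕 : Set FDSpace.{u}} (c : Chain 𝓕)

/-- The inclusion of `Eₙ` into `Eₘ` for `n ≤ m`. -/
def incl {n m : ℕ} (h : n ≤ m) : c.space n →ₗᵢ[ℝ] c.space m :=
  Nat.leRecOn (C := fun m => c.space n →ₗᵢ[ℝ] c.space m) h (fun {k} e => (c.emb k).comp e)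
    LinearIsometry.id

theorem incl_self (n : ℕ) (x : c.space n) : c.incl le_rfl x = x := by
  unfold incl
  rw [Nat.leRecOn_self]
  rfl

theorem incl_succ {n m : ℕ} (h : n ≤ m) (x : c.space n) :
    c.incl (h.trans (Nat.le_succ m)) x = c.emb m (c.incl h x) := by
  unfold incl
  rw [Nat.leRecOn_succ h]
  rfl

/-- The inclusion of `Eₙ` into `Eₘ` for `n ≤ m`, and zero for `m < n`. -/
def inclOrZero (n m : ℕ) : c.space n →ₗ[ℝ] c.space m :=
  if h : n ≤ m then (c.incl h).toLinearMap else 0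

theorem inclOrZero_of_le {n m : ℕ} (h : n ≤ m) (x : c.space n) :
    c.inclOrZero n m x = c.incl h x := by
  rw [inclOrZero, dif_pos h]
  rfl

/-- The thread of an element of `Eₙ`. -/
def thread (n : ℕ) : c.space n →ₗ[ℝ] c.Thread :=
  LinearMap.codRestrict c.threads (LinearMap.pi fun m => c.inclOrZero n m) fun x =>
   ⟨n, fun m hm => by
    simp only [LinearMap.pi_apply]
    rw [c.inclOrZero_of_le hm, c.inclOrZero_of_le (hm.trans (Nat.le_succ m))]
    exact c.incl_succ hm x⟩

theorem thread_term {n m : ℕ} (h : n ≤ m) (x : c.space n) :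
    (c.thread n x).term m = c.incl h x := c.inclOrZero_of_le h x

variable {c} in
theorem Thread.norm_eq_of_eventually {x : c.Thread} {a : ℝ} {N : ℕ}
    (h : ∀ n ≥ N, ‖x.term n‖ = a) : ‖x‖ = a :=
  tendsto_nhds_unique x.tendsto_norm <| tendsto_const_nhds.congr' <|
    eventually_atTop.2 ⟨N, fun n hn => (h n hn).symm⟩

variable {c} in
theorem Thread.mk_eq_of_eventually {x y : c.Thread} {N : ℕ}
    (h : ∀ n ≥ N, x.term n = y.term n) :
    (SeparationQuotient.mk x : c.Union) = SeparationQuotient.mk y := by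
  rw [← sub_eq_zero, ← SeparationQuotient.mk_sub, ← norm_eq_zero, SeparationQuotient.norm_mk]
  refine Thread.norm_eq_of_eventually (N := N) fun n hn => ?_
  change ‖x.term n - y.term n‖ = 0
  rw [h n hn, sub_self, norm_zero]

/-- The inclusion of `Eₙ` into the union. -/
noncomputable def toUnion (n : ℕ) : c.space n →ₗᵢ[ℝ] c.Union where
  toLinearMap := (SeparationQuotient.mkCLM ℝ c.Thread).toLinearMap ∘ₗ c.thread n
  norm_map' x := (SeparationQuotient.norm_mk _).trans <|
    Thread.norm_eq_of_eventually (N := n) fun m hm => by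
      rw [c.thread_term hm, LinearIsometry.norm_map]

theorem toUnion_emb (n : ℕ) (x : c.space n) : c.toUnion (n + 1) (c.emb n x) = c.toUnion n x := by
  refine Thread.mk_eq_of_eventually (N := n + 1) fun m hm => ?_
  rw [c.thread_term hm, c.thread_term ((Nat.le_succ n).trans hm)]
  induction m, hm using Nat.le_induction with
  | base => rw [incl_self, c.incl_succ le_rfl, incl_self]
  | succ m hm ih => rw [c.incl_succ hm, ih, c.incl_succ ((Nat.le_succ n).trans hm)]

theorem toUnion_incl {n m : ℕ} (h : n ≤ m) (x : c.space n) :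
    c.toUnion m (c.incl h x) = c.toUnion n x := by
  induction m, h using Nat.le_induction with
  | base => rw [incl_self]
  | succ m hm ih => rw [c.incl_succ hm, toUnion_emb, ih]

theorem exists_toUnion_eq (z : c.Union) : ∃ n x, c.toUnion n x = z := by
  obtain ⟨x, rfl⟩ := SeparationQuotient.surjective_mk z
  obtain ⟨N, hN⟩ := x.2
  refine ⟨N, x.term N, Thread.mk_eq_of_eventually (N := N) fun m hm => ?_⟩
  rw [c.thread_term hm]
  induction m, hm using Nat.le_induction with
  | base => exact c.incl_self N _
  | succ m hm ih =>
    rw [c.incl_succ hm, ih]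
    exact (hN m hm).symm

/-- The inclusion of `Eₙ` into the completion of the union. -/
noncomputable def toCompletion (n : ℕ) : c.space n →ₗᵢ[ℝ] c.Completion :=
  (UniformSpace.Completion.toComplₗᵢ (𝕜 := ℝ) (E := c.Union)).comp (c.toUnion n)

theorem toCompletion_emb (n : ℕ) (x : c.space n) :
    c.toCompletion (n + 1) (c.emb n x) = c.toCompletion n x :=
  congrArg (UniformSpace.Completion.toComplₗᵢ (𝕜 := ℝ)) (c.toUnion_emb n x)

theorem toCompletion_incl {n m : ℕ} (h : n ≤ m) (x : c.space n) :
    c.toCompletion m (c.incl h x) = c.toCompletion n x :=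
  congrArg (UniformSpace.Completion.toComplₗᵢ (𝕜 := ℝ)) (c.toUnion_incl h x)

theorem exists_toCompletion_near (z : c.Completion) {ε : ℝ} (hε : 0 < ε) :
    ∃ n x, ‖c.toCompletion n x - z‖ < ε := by
  obtain ⟨_, ⟨y, rfl⟩, hy⟩ := Metric.mem_closure_iff.1
    (UniformSpace.Completion.denseRange_coe (α := c.Union) z) ε hε
  obtain ⟨n, x, rfl⟩ := c.exists_toUnion_eq y
  refine ⟨n, x, ?_⟩
  rwa [dist_comm, dist_eq_norm] at hy

theorem separableSpace_completion : TopologicalSpace.SeparableSpace c.Completion := by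
  have h : ∀ n, TopologicalSpace.IsSeparable (Set.range (c.toCompletion n)) := fun n => by
    have : ProperSpace (c.space n) := FiniteDimensional.proper_real _
    exact TopologicalSpace.isSeparable_range (c.toCompletion n).continuous
  have h2 := (TopologicalSpace.IsSeparable.iUnion h).closure
  refine TopologicalSpace.isSeparable_univ_iff.1 (h2.mono fun z _ => ?_)
  refine Metric.mem_closure_iff.2 fun ε hε => ?_
  obtain ⟨n, x, hx⟩ := c.exists_toCompletion_near z hε
  exact ⟨_, Set.mem_iUnion.2 ⟨n, x, rfl⟩, by rwa [dist_comm, dist_eq_norm]⟩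

/-- A linear map into the completion, defined on `ℝᵏ`, is approximated by maps into the `Eₙ`. -/
theorem exists_linearMap_near {k : ℕ} (T : (Fin k → ℝ) →ₗ[ℝ] c.Completion) {ε : ℝ} (hε : 0 < ε) :
    ∃ (m : ℕ) (S : (Fin k → ℝ) →ₗ[ℝ] c.space m),
      ∀ w, ‖c.toCompletion m (S w) - T w‖ ≤ ε * ‖w‖ := by
  -- Each of the `k` basis vectors gets this share of the error; `+ 1` covers `k = 0`.
  have hη : 0 < ε / (k + 1) := by positivity
  choose n x hx using fun i : Fin k =>
    c.exists_toCompletion_near (T (Pi.single i 1)) hη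
  let m := Finset.univ.sup n
  have hm : ∀ i, n i ≤ m := fun i => Finset.le_sup (Finset.mem_univ i)
  refine ⟨m, Fintype.linearCombination ℝ fun i => c.incl (hm i) (x i), fun w => ?_⟩
  rw [Fintype.linearCombination_apply, map_sum]
  have hT : T w = ∑ i, w i • T (Pi.single i 1) := by
    rw [LinearMap.pi_apply_eq_sum_univ T]
    refine Finset.sum_congr rfl fun i _ => ?_
    congr 2
    ext j
    simp [Pi.single_apply, eq_comm]
  rw [hT, ← Finset.sum_sub_distrib]
  refine (norm_sum_le _ _).trans ?_
  have h1 : ∀ i ∈ Finset.univ, ‖c.toCompletion m (w i • c.incl (hm i) (x i)) -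
      w i • T (Pi.single i 1)‖ ≤ ‖w‖ * (ε / (k + 1)) := fun i _ => by
    rw [map_smul, toCompletion_incl, ← smul_sub, norm_smul]
    exact mul_le_mul (norm_le_pi_norm w i) (hx i).le (norm_nonneg _) (norm_nonneg _)
  refine (Finset.sum_le_sum h1).trans ?_
  rw [Finset.sum_const, Finset.card_univ, Fintype.card_fin, nsmul_eq_mul]
  calc (k : ℝ) * (‖w‖ * (ε / (k + 1))) = ε * ‖w‖ * (k / (k + 1)) := by ring
    _ ≤ ε * ‖w‖ * 1 := by
      refine mul_le_mul_of_nonneg_left ?_ (by positivity)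
      rw [div_le_one (by positivity)]
      linarith
    _ = ε * ‖w‖ := mul_one _

end Chain

/-! ### Countable dense families of problems -/

namespace ExtensionProblem

section

variable {k : ℕ} {E : Type u} [NormedAddCommGroup E] [NormedSpace ℝ E]

/-- The problems `Q` and `R` differ by at most `δ` on the unit ball. -/
def IsNear (δ : ℝ) (Q R : ExtensionProblem k E) : Prop :=
  ∀ w, |Q.size w - R.size w| ≤ δ * ‖w‖ ∧ |Q.error w - R.error w| ≤ δ * ‖w‖ ∧
    ‖Q.map w - R.map w‖ ≤ δ * ‖w‖

theorem IsNear.of_unitBall {δ : ℝ} {Q R : ExtensionProblem k E}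
    (h : ∀ w, ‖w‖ ≤ 1 → |Q.size w - R.size w| ≤ δ ∧ |Q.error w - R.error w| ≤ δ ∧
      ‖Q.map w - R.map w‖ ≤ δ) : IsNear δ Q R := fun w => by
  have hw : w = ‖w‖ • (‖w‖⁻¹ • w) := by
    rcases eq_or_ne w 0 with rfl | hw
    · simp
    · rw [smul_inv_smul₀ (norm_ne_zero_iff.2 hw)]
  have hv : ‖‖w‖⁻¹ • w‖ ≤ 1 := by
    rw [norm_smul, norm_inv, norm_norm]
    exact inv_mul_le_one
  obtain ⟨h1, h2, h3⟩ := h _ hv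
  generalize ‖w‖⁻¹ • w = v at *
  have h0 := norm_nonneg w
  generalize ‖w‖ = r at *
  subst hw
  simp only [map_smul_eq_mul, map_smul, ← mul_sub, ← smul_sub, norm_smul, abs_mul,
    Real.norm_eq_abs, abs_of_nonneg h0]
  rw [mul_comm δ]
  exact ⟨mul_le_mul_of_nonneg_left h1 h0, mul_le_mul_of_nonneg_left h2 h0,
    mul_le_mul_of_nonneg_left h3 h0⟩

theorem _root_.Seminorm.continuous_of_pi (p : Seminorm ℝ (Fin k → ℝ)) : Continuous p :=
  (ConvexOn.locallyLipschitz p.convexOn).continuous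

/-- The data of a problem, restricted to the unit ball. -/
def onUnitBall (Q : ExtensionProblem k E) :
    C(Metric.closedBall (0 : Fin k → ℝ) 1, ℝ × ℝ × E) where
  toFun w := (Q.size w, Q.error w, Q.map w)
  continuous_toFun :=
    (Q.size.continuous_of_pi.comp continuous_subtype_val).prodMk
      ((Q.error.continuous_of_pi.comp continuous_subtype_val).prodMk
        (Q.map.continuous_of_finiteDimensional.comp continuous_subtype_val))

instance : Nonempty (ExtensionProblem k E) :=
  ⟨{ size := 0, error := 0, map := 0, compat := by simp }⟩

/-- Restriction to the compact unit ball places the problems in a separable metric space of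
continuous functions. Subsets of it are separable, so the dense sequence can consist of genuine
problems. -/
theorem exists_dense [FiniteDimensional ℝ E] :
    ∃ D : ℕ → ExtensionProblem k E, ∀ (Q : ExtensionProblem k E) (δ : ℝ), 0 < δ →
      ∃ j, IsNear δ (D j) Q := by
  have : ProperSpace E := FiniteDimensional.proper_real E
  let S := Set.range (onUnitBall (k := k) (E := E))
  have : Nonempty S := (Set.range_nonempty _).to_subtype
  choose D hD using fun j => (TopologicalSpace.denseSeq S j).2
  refine ⟨D, fun Q δ hδ => ?_⟩
  obtain ⟨j, hj⟩ := Metric.denseRange_iff.1 (TopologicalSpace.denseRange_denseSeq S)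
    ⟨onUnitBall Q, Q, rfl⟩ δ hδ
  refine ⟨j, IsNear.of_unitBall fun w hw => ?_⟩
  have h1 : dist (onUnitBall (D j)) (onUnitBall Q) ≤ δ := by
    rw [hD j, dist_comm]
    exact hj.le
  have h2 := (ContinuousMap.dist_apply_le_dist
    (⟨w, by simpa using hw⟩ : Metric.closedBall (0 : Fin k → ℝ) 1)).trans h1
  have h3 : max |(D j).size w - Q.size w| (max |(D j).error w - Q.error w|
      (dist ((D j).map w) (Q.map w))) ≤ δ := h2
  rw [dist_eq_norm] at h3
  simpa only [max_le_iff] using h3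

end

/-- A dense sequence of problems in a finite-dimensional space. -/
noncomputable def dense (k : ℕ) (E : FDSpace.{u}) : ℕ → ExtensionProblem k E :=
  exists_dense.choose

theorem dense_spec {k : ℕ} {E : FDSpace.{u}} (Q : ExtensionProblem k E) {δ : ℝ} (hδ : 0 < δ) :
    ∃ j, IsNear δ (dense k E j) Q :=
  exists_dense.choose_spec Q δ hδ

end ExtensionProblem

/-! ### Odd's strategy -/

open ExtensionProblem

variable {𝓕 : Set FDSpace.{u}}

/-- The `j`-th problem of the space played at time `m`, pushed forward to the last space. -/
noncomputable def Position.problem (k m j : ℕ) {n : ℕ} {E : FDSpace.{u}} :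
    Position 𝓕 n E → ExtensionProblem k E
  | .first E _ => dense k E j
  | @Position.extend _ n _ p v =>
      -- The new space has time `n + 1`. For `m` beyond that the value is a dummy, never needed by
      -- the strategy.
      if m ≤ n then (p.problem k m j).push v.emb else dense k v.space j

theorem Position.problem_extend_of_le {k m j n : ℕ} {E : FDSpace.{u}} (p : Position 𝓕 n E)
    (h : m ≤ n) (v : Move 𝓕 E) :
    (p.extend v).problem k m j = (p.problem k m j).push v.emb := by
  rw [Position.problem, if_pos h]

theorem Position.problem_extend_of_lt {k m j n : ℕ} {E : FDSpace.{u}} (p : Position 𝓕 n E)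
    (h : n < m) (v : Move 𝓕 E) : (p.extend v).problem k m j = dense k v.space j := by
  rw [Position.problem, if_neg (by omega)]

theorem Position.mem {n : ℕ} {E : FDSpace.{u}} : Position 𝓕 n E → E ∈ 𝓕
  | .first _ h => h
  | .extend _ v => v.mem

/-- The almost isometric map of the amalgam into `F` is exactly isometric on `E`, so it yields a
legal move as well as a solution. -/
theorem Dominating.exists_move (h𝓕 : Dominating 𝓕) {E : FDSpace.{u}} (hE : E ∈ 𝓕) {k : ℕ}
    (Q : ExtensionProblem k E) {ε : ℝ} (hε : 0 < ε) :
    ∃ v : Move 𝓕 E, (Q.push v.emb).Solvable ε := by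
  obtain ⟨Z, J, I, hI, hIJ⟩ := Q.exists_amalgam
  obtain ⟨F, hF, f, hf, hfJ⟩ := h𝓕 E hE Z J ε hε
  refine ⟨⟨F, hF, ⟨f ∘ₗ J.toLinearMap, hfJ⟩⟩, f ∘ₗ I, fun w => ?_⟩
  obtain ⟨h1, h2⟩ := hf (I w)
  rw [hI w] at h1 h2
  refine ⟨h1, h2, ?_⟩
  have h3 := (hf (I w - J (Q.map w))).2
  rw [map_sub] at h3
  exact h3.trans (mul_le_mul_of_nonneg_left (hIJ w) (by linarith))

/-- Odd solves one problem at each of his moves, so that every problem is solved eventually. -/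
theorem Dominating.exists_strategy (h𝓕 : Dominating 𝓕) :
    ∃ σ : OddStrategy 𝓕, ∀ m k j l : ℕ, ∃ K : ℕ, m ≤ 2 * K ∧
      ∀ (E : FDSpace.{u}) (p : Position 𝓕 (2 * K) E),
        ((p.problem k m j).push (σ K E p).emb).Solvable (1 / (l + 1)) := by
  choose σ hσ using fun (m k j l n : ℕ) (E : FDSpace.{u}) (p : Position 𝓕 n E) =>
    h𝓕.exists_move p.mem (p.problem k m j) (ε := 1 / ((l : ℝ) + 1)) Nat.one_div_pos_of_nat
  -- `K` codes `(m, k, j, l)`. Since `m ≤ K ≤ 2 * K`, the space whose problem is due has already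
  -- been played.
  refine ⟨fun K E p => σ (Nat.unpair K).1 (Nat.unpair (Nat.unpair K).2).1
    (Nat.unpair (Nat.unpair (Nat.unpair K).2).2).1
    (Nat.unpair (Nat.unpair (Nat.unpair K).2).2).2 _ E p, fun m k j l => ?_⟩
  obtain ⟨K, rfl, rfl, rfl, rfl⟩ : ∃ K, (Nat.unpair K).1 = m ∧
      (Nat.unpair (Nat.unpair K).2).1 = k ∧
      (Nat.unpair (Nat.unpair (Nat.unpair K).2).2).1 = j ∧
      (Nat.unpair (Nat.unpair (Nat.unpair K).2).2).2 = l :=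
    ⟨Nat.pair m (Nat.pair k (Nat.pair j l)), by simp⟩
  exact ⟨K, (Nat.unpair_left_le K).trans (Nat.le_mul_of_pos_left K two_pos),
    fun E p => hσ _ _ _ _ _ E p⟩

/-! ### The completion of a play is Gurarii -/

namespace Chain

variable (c : Chain 𝓕)

theorem push_toCompletion_emb {k n : ℕ} (Q : ExtensionProblem k (c.space n)) :
    (Q.push (c.emb n)).push (c.toCompletion (n + 1)) = Q.push (c.toCompletion n) := by
  unfold ExtensionProblem.push
  congr 1
  ext i
  simp [toCompletion_emb]

/-- In the completion, a problem is unaffected by the time that passes before Odd attends to it. -/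
theorem push_problem (k m j : ℕ) {n : ℕ} (h : m ≤ n) :
    ((c.position n).problem k m j).push (c.toCompletion n) =
      (dense k (c.space m) j).push (c.toCompletion m) := by
  induction n, h using Nat.le_induction with
  | base =>
    congr 1
    cases m with
    | zero => rfl
    | succ m => exact (c.position m).problem_extend_of_lt (Nat.lt_succ_self m) (c.move m)
  | succ n hn ih =>
    have h : (c.position (n + 1)).problem k m j = ((c.position n).problem k m j).push (c.emb n) :=
      (c.position n).problem_extend_of_le hn (c.move n)
    rw [h, push_toCompletion_emb, ih]

/-- Every problem of the dense sequences is solved in the completion. -/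
def SolvesDense : Prop :=
  ∀ (m k j l : ℕ), ((dense k (c.space m) j).push (c.toCompletion m)).Solvable (1 / (l + 1))

theorem Follows.solvesDense {c : Chain 𝓕} {σ : OddStrategy 𝓕} (hc : c.Follows σ)
    (hσ : ∀ m k j l : ℕ, ∃ K : ℕ, m ≤ 2 * K ∧
      ∀ (E : FDSpace.{u}) (p : Position 𝓕 (2 * K) E),
        ((p.problem k m j).push (σ K E p).emb).Solvable (1 / (l + 1))) : c.SolvesDense := by
  intro m k j l
  obtain ⟨K, hm, hK⟩ := hσ m k j l
  have h := hK _ (c.position _)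
  rw [← hc] at h
  rw [← c.push_problem k m j hm, ← c.push_toCompletion_emb]
  exact h.push _

/-- With a projection `P` of `B` onto `A`, the map `e ∘ P` is approximated by a problem in some
`Eₘ`, then by a dense one. Its solution `g` is almost isometric and close to `e` on `A`; adding `(e
- g) ∘ P` makes it agree with `e` there. -/
theorem SolvesDense.isGurarii {c : Chain 𝓕} (hc : c.SolvesDense) : IsGurarii c.Completion where
  complete := inferInstance
  separable := c.separableSpace_completion
  extension ε hε B A e := by
    let φ : B ≃ₗ[ℝ] (Fin (Module.finrank ℝ B) → ℝ) := (Module.finBasis ℝ B).equivFun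
    obtain ⟨P, hP⟩ := A.subtype.exists_leftInverse_of_injective A.ker_subtype
    have hPA : ∀ a : A, P a = a := fun a => LinearMap.congr_fun hP a
    obtain ⟨C, hC0, hC⟩ : ∃ C : ℝ, 0 < C ∧ ∀ b, ‖P b‖ ≤ C * ‖b‖ :=
      (LinearMap.toContinuousLinearMap P).bound
    obtain ⟨M, hM0, hM⟩ : ∃ M : ℝ, 0 < M ∧ ∀ b, ‖φ b‖ ≤ M * ‖b‖ :=
      (LinearMap.toContinuousLinearMap φ.toLinearMap).bound
    -- `g` has distortion `3 * δ` and differs from `e` on `A` by `6 * δ`; the correction through `P`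
    -- multiplies the latter by `C`.
    obtain ⟨l, hl⟩ := exists_nat_one_div_lt (show 0 < ε / (3 + 6 * C) by positivity)
    set δ : ℝ := 1 / (l + 1) with hδ
    have hδ0 : 0 < δ := Nat.one_div_pos_of_nat
    have hδ1 : δ ≤ 1 := by
      rw [hδ, div_le_one (by positivity)]
      linarith [(Nat.cast_nonneg l : (0 : ℝ) ≤ l)]
    have hη : 0 < δ / M := by positivity
    have hnear : ∀ b, δ / M * ‖φ b‖ ≤ δ * ‖b‖ := fun b => by
      calc _ ≤ δ / M * (M * ‖b‖) := mul_le_mul_of_nonneg_left (hM b) hη.le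
        _ = δ * ‖b‖ := by field_simp
    let T : (Fin (Module.finrank ℝ B) → ℝ) →ₗ[ℝ] c.Completion :=
      e.toLinearMap ∘ₗ P ∘ₗ φ.symm.toLinearMap
    have hT : ∀ b, T (φ b) = e (P b) := fun b => by simp [T]
    obtain ⟨m, S, hS⟩ := c.exists_linearMap_near T hη
    have hS' : ∀ b, ‖c.toCompletion m (S (φ b)) - e (P b)‖ ≤ δ * ‖b‖ := fun b => by
      rw [← hT]
      exact (hS _).trans (hnear b)
    let N : Seminorm ℝ (Fin (Module.finrank ℝ B) → ℝ) :=
      (normSeminorm ℝ B).comp φ.symm.toLinearMap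
    have hN : ∀ b, N (φ b) = ‖b‖ := fun b => by simp [N]
    let R : Seminorm ℝ (Fin (Module.finrank ℝ B) → ℝ) :=
      (normSeminorm ℝ B).comp ((LinearMap.id - A.subtype ∘ₗ P) ∘ₗ φ.symm.toLinearMap)
    have hR : ∀ b, R (φ b) = ‖b - P b‖ := fun b => by simp [R]
    let d : NNReal := ⟨δ, hδ0.le⟩
    let Q : ExtensionProblem (Module.finrank ℝ B) (c.space m) :=
      { size := N
        -- `R` vanishes on `A`, which keeps the solution near `e` there; `d • N` absorbs the
        -- replacement of `e ∘ P` by `S`.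
        error := R + d • N
        map := S
        compat := fun w => by
          obtain ⟨b, rfl⟩ := φ.surjective w
          change |N (φ b) - ‖S (φ b)‖| ≤ R (φ b) + δ * N (φ b)
          rw [hN, hR]
          have h1 := abs_norm_sub_norm_le b (P b : B)
          have h2 := (abs_norm_sub_norm_le _ _).trans (hS' b)
          rw [LinearIsometry.norm_map, LinearIsometry.norm_map] at h2
          have h3 : ‖(P b : B)‖ = ‖P b‖ := rfl
          rw [h3] at h1
          rw [abs_le] at h1 h2 ⊢
          constructor <;> linarith }
    obtain ⟨j, hj⟩ := dense_spec Q hη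
    obtain ⟨f, hf⟩ := hc m _ j l
    set D := dense (Module.finrank ℝ B) (c.space m) j
    let g : B →ₗ[ℝ] c.Completion := f ∘ₗ φ.toLinearMap
    have hg : ∀ b, |‖g b‖ - ‖b‖| ≤ 3 * δ * ‖b‖ := fun b => by
      obtain ⟨h1, h2, -⟩ := hf (φ b)
      have h3 : |D.size (φ b) - N (φ b)| ≤ _ := (hj (φ b)).1.trans (hnear b)
      rw [hN] at h3
      change _ * D.size (φ b) ≤ ‖g b‖ at h1
      change ‖g b‖ ≤ _ * D.size (φ b) at h2
      have hb := norm_nonneg b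
      rw [abs_le] at h3 ⊢
      rw [← hδ] at h1 h2
      constructor <;> nlinarith
    have hgA : ∀ a : A, ‖e a - g a‖ ≤ 6 * δ * ‖a‖ := fun a => by
      obtain ⟨-, -, h1⟩ := hf (φ a)
      obtain ⟨-, h2, h3⟩ := hj (φ a)
      have h4 : |D.error (φ a) - (R (φ a) + δ * N (φ a))| ≤ _ := h2.trans (hnear a)
      rw [hR, hN, hPA, sub_self, norm_zero, zero_add] at h4
      have h5 : ‖c.toCompletion m (D.map (φ a)) - c.toCompletion m (S (φ a))‖ ≤
          δ * ‖(a : B)‖ := by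
        rw [← map_sub, LinearIsometry.norm_map]
        exact h3.trans (hnear a)
      have h6 := hS' a
      rw [hPA] at h6
      change ‖g a - c.toCompletion m (D.map (φ a))‖ ≤
        (1 + _) * D.error (φ a) at h1
      rw [← hδ] at h1
      have h7 : g a - e a = g a - c.toCompletion m (D.map (φ a)) +
        (c.toCompletion m (D.map (φ a)) - c.toCompletion m (S (φ a))) +
        (c.toCompletion m (S (φ a)) - e a) := by abel
      rw [norm_sub_rev, h7]
      refine (norm_add₃_le).trans ?_
      change _ ≤ 6 * δ * ‖(a : B)‖
      rw [abs_le] at h4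
      have h8 : (1 + δ) * D.error (φ a) ≤ 2 * (2 * δ * ‖(a : B)‖) := by
        refine mul_le_mul (by linarith) (by linarith) (apply_nonneg _ _) (by norm_num)
      linarith
    refine ⟨g + (e.toLinearMap - g ∘ₗ A.subtype) ∘ₗ P, fun a => ?_, fun b => ?_⟩
    · simp [hPA]
    · change _ ≤ ‖g b + (e (P b) - g (P b))‖ ∧ ‖g b + (e (P b) - g (P b))‖ ≤ _
      have h1 := (hgA (P b)).trans (mul_le_mul_of_nonneg_left (hC b) (by positivity))
      have h2 := hg b
      have h3 := norm_add_le (g b) (e (P b) - g (P b))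
      have h4 := norm_sub_le_norm_add (g b) (e (P b) - g (P b))
      have h5 : δ * (3 + 6 * C) * ‖b‖ ≤ ε * ‖b‖ :=
        mul_le_mul_of_nonneg_right ((lt_div_iff₀ (by positivity)).1 hl).le (norm_nonneg b)
      rw [abs_le] at h2
      constructor <;> linarith

end Chain

/-! ### Existence of a play, and the theorem -/

/-- The move after a position in which Odd follows `σ` and Eve keeps the space. -/
noncomputable def OddStrategy.next (σ : OddStrategy 𝓕) (n : ℕ) (s : Σ E, Position 𝓕 n E) :
    Move 𝓕 s.1 :=
  -- Parity is tested by the equation along which the position is transported to the index type of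
  -- `σ`.
  if h : n = 2 * (n / 2) then σ (n / 2) s.1 (h ▸ s.2)
  else ⟨s.1, s.2.mem, LinearIsometry.id⟩

theorem OddStrategy.next_two_mul (σ : OddStrategy 𝓕) (k : ℕ) (s : Σ E, Position 𝓕 (2 * k) E) :
    σ.next (2 * k) s = σ k s.1 s.2 := by
  have h : ∀ (j : ℕ) (h : 2 * k = 2 * j), σ j s.1 (h ▸ s.2) = σ k s.1 s.2 := fun j hj => by
    obtain rfl : k = j := by omega
    rfl
  rw [OddStrategy.next, dif_pos (by omega)]
  exact h _ _

/-- The positions of a play in which Odd follows `σ`. -/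
noncomputable def OddStrategy.positions (σ : OddStrategy 𝓕) (s : Σ E, Position 𝓕 0 E) :
    ∀ n, Σ E, Position 𝓕 n E
  | 0 => s
  | n + 1 => ⟨_, (σ.positions s n).2.extend (σ.next n (σ.positions s n))⟩

/-- A play in which Odd follows `σ`. -/
noncomputable def OddStrategy.play (σ : OddStrategy 𝓕) (s : Σ E, Position 𝓕 0 E) : Chain 𝓕 where
  space n := (σ.positions s n).1
  mem n := (σ.positions s n).2.mem
  emb n := (σ.next n (σ.positions s n)).emb

theorem OddStrategy.play_follows (σ : OddStrategy 𝓕) {E : FDSpace.{u}} (hE : E ∈ 𝓕) :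
    (σ.play ⟨E, .first E hE⟩).Follows σ := by
  have h : ∀ n, (σ.play ⟨E, .first E hE⟩).position n = (σ.positions ⟨E, .first E hE⟩ n).2 := by
    intro n
    induction n with
    | zero => rfl
    | succ n ih =>
      rw [Chain.position, ih]
      rfl
  intro k
  rw [h]
  exact σ.next_two_mul k _

theorem Dominating.exists_isGurarii_strategy (h𝓕 : Dominating 𝓕) :
    ∃ σ : OddStrategy 𝓕, ∀ c : Chain 𝓕, c.Follows σ → IsGurarii c.Completion := by
  obtain ⟨σ, hσ⟩ := h𝓕.exists_strategy
  exact ⟨σ, fun c hc => (hc.solvesDense hσ).isGurarii⟩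

theorem dominating_univ : Dominating (Set.univ : Set FDSpace.{u}) := fun E _ X e ε hε =>
  ⟨X, Set.mem_univ X, LinearMap.id, fun x => by
    have := norm_nonneg x
    simp only [LinearMap.id_apply]
    constructor <;> nlinarith, fun x => e.norm_map x⟩

theorem IsGurarii.nonempty_linearIsometryEquiv {G H : Type u}
    [NormedAddCommGroup G] [NormedSpace ℝ G] [NormedAddCommGroup H] [NormedSpace ℝ H]
    (hG : IsGurarii G) (hH : IsGurarii H) : Nonempty (G ≃ₗᵢ[ℝ] H) := by
  have := hG.complete
  have := hH.complete
  have := hG.separable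
  have := hH.separable
  exact SolvesAll.nonempty_linearIsometryEquiv (fun _ Q _ hε => hG.solvable Q hε)
    fun _ Q _ hε => hH.solvable Q hε

end BMGame

theorem theorem4p1 (𝓕 : Set BMGame.FDSpace.{u})
    (hiso : BMGame.ClosedUnderIsometries 𝓕) (hdom : BMGame.Dominating 𝓕) :
    ∃ (G : Type u) (_ : NormedAddCommGroup G) (_ : NormedSpace ℝ G),
      BMGame.IsGurarii G ∧
      (∀ (H : Type u) [NormedAddCommGroup H] [NormedSpace ℝ H],
        BMGame.IsGurarii H → Nonempty (H ≃ₗᵢ[ℝ] G)) ∧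
      ∃ σ : BMGame.OddStrategy 𝓕, ∀ c : BMGame.Chain 𝓕, c.Follows σ →
        Nonempty (c.Completion ≃ₗᵢ[ℝ] G) := by
  -- `𝓕` may be empty and have no plays, so `G` comes from the class of all spaces.
  obtain ⟨τ, hτ⟩ := BMGame.dominating_univ.{u}.exists_isGurarii_strategy
  let E : BMGame.FDSpace.{u} := { carrier := PUnit }
  have hG := hτ _ (τ.play_follows (Set.mem_univ E))
  obtain ⟨σ, hσ⟩ := hdom.exists_isGurarii_strategy
  exact ⟨_, inferInstance, inferInstance, hG, fun H _ _ hH => hH.nonempty_linearIsometryEquiv hG,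
    σ, fun c hc => (hσ c hc).nonempty_linearIsometryEquiv hG⟩
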